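/- Let $\mathbb D$ be the open unit disc in $\mathbb C$ and let $\mathrm{Hol}(\mathbb D)$ be the space of holomorphic functions on $\mathbb D$ with the topology of uniform convergence on compact sets. Let $X$ be a complex Banach space of holomorphic functions on $\mathbb D$ that contains the constant function $\mathbf 1$ and for which the inclusion $X\to\mathrm{Hol}(\mathbb D)$ is continuous. Let $w:\mathbb D\to\mathbb C$ and $\varphi:\mathbb D\to\mathbb D$ be holomorphic, where $\varphi$ is not an elliptic automorphism (an automorphism of $\mathbb D$ with a fixed point in $\mathbb D$, the identity included), and write $\varphi_k$ for the $k$-th iterate of $\varphi$ ($\varphi_0=\mathrm{id}$). Suppose that the weighted composition operator $(T_{w,\varphi}f)(z)=w(z)f(\varphi(z))$ is a bounded operator on $X$ with $\sup_{n\ge1}\|T_{w,\varphi}^n\|<\infty$, that the Denjoy–Wolff point $\alpha$ of $\varphi$ (the point to which the iterates $\varphi_n$ converge uniformly on compact subsets of $\mathbb D$) lies in $\mathbb D$, and that either $|w(\alpha)|<1$ or $w(\alpha)=1$. Then the sequence $(T_{w,\varphi}^n)_n$ converges in operator norm if and only if $r_e(T_{w,\varphi})<1$, where $r_e(T)=\sup\{|\mu|:\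 T-\mu I \text{ is not Fredholm}\}$ is the essential spectral radius (with $\sup\emptyset=0$). Moreover, whenever $(T_{w,\varphi}^n)_n$ converges in operator norm, its limit $P$ is as follows. If $|w(\alpha)|<1$, then $P=0$. If $w(\alpha)=1$, then the products $w(z)\,w(\varphi(z))\cdots w(\varphi_{n-1}(z))$ converge, uniformly on compact subsets of $\mathbb D$, to a function $\widetilde w\in X$, and $P$ is the rank-one projection $Pf=f(\alpha)\,\widetilde w$ for $f\in X$. -/

import Mathlib

open Filter Topology
open scoped ENNReal NNReal Complex.UnitDisc

namespace WeightedComp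

/-- Holomorphic functions on the open unit disc `𝔻`. -/
def IsHolomorphic (f : 𝔻 → ℂ) : Prop :=
  ∃ F : ℂ → ℂ, DifferentiableOn ℂ F (Metric.ball 0 1) ∧ ∀ z : 𝔻, f z = F z

/-- The space `Hol(𝔻)`, with the topology of uniform convergence on compact subsets of the disc
(the compact-open topology inherited from `C(𝔻, ℂ)`). -/
noncomputable def Hol : Submodule ℂ C(𝔻, ℂ) where
  carrier := {f | IsHolomorphic f}
  zero_mem' := ⟨0, differentiableOn_const 0, fun _ => rfl⟩
  add_mem' := by
    rintro f g ⟨F, hF, hfF⟩ ⟨G, hG, hgG⟩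
    exact ⟨F + G, hF.add hG, fun z => by simp [hfF z, hgG z]⟩
  smul_mem' := by
    rintro c f ⟨F, hF, hfF⟩
    exact ⟨c • F, hF.const_smul c, fun z => by simp [hfF z]⟩

/-- Evaluation at a point of the disc of the holomorphic function attached to an element of `X`. -/
noncomputable def ev {X : Type*} [NormedAddCommGroup X] [NormedSpace ℂ X] (ι : X →L[ℂ] Hol) (f : X) (z : 𝔻) : ℂ :=
  (ι f : C(𝔻, ℂ)) z

/-- `X`, viewed inside `Hol(𝔻)` through `ι`, is a space of holomorphic functions on the disc
containing the constant function `1`: the continuous linear map `ι` is injective and `1` is in its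
range. -/
structure IsHolomorphicFunctionSpace {X : Type*} [NormedAddCommGroup X] [NormedSpace ℂ X]
    (ι : X →L[ℂ] Hol) : Prop where
  injective : Function.Injective ι
  one_mem : ∃ e : X, ∀ z : 𝔻, ev ι e z = 1

/-- The bounded operator `T` on `X` is the weighted composition operator
`(T f)(z) = w(z) f(φ(z))`. -/
def IsWeightedComposition {X : Type*} [NormedAddCommGroup X] [NormedSpace ℂ X]
    (ι : X →L[ℂ] Hol) (w : 𝔻 → ℂ) (φ : 𝔻 → 𝔻) (T : X →L[ℂ] X) : Prop :=
  ∀ (f : X) (z : 𝔻), ev ι (T f) z = w z * ev ι f (φ z)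

/-- `sup_{n ≥ 1} ‖T ^ n‖ < ∞`. -/
def IsPowerBounded {X : Type*} [NormedAddCommGroup X] [NormedSpace ℂ X] (T : X →L[ℂ] X) : Prop :=
  ∃ C : ℝ, ∀ n : ℕ, 1 ≤ n → ‖T ^ n‖ ≤ C

/-- Sequences of complex functions on the disc converging uniformly on compact subsets. -/
def TendstoOnCompacts (F : ℕ → 𝔻 → ℂ) (g : 𝔻 → ℂ) : Prop :=
  ∀ K : Set 𝔻, IsCompact K → TendstoUniformlyOn F g atTop K

/-- A holomorphic self-map of the disc is an elliptic automorphism if it is a bijection with a fixed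
point in the disc (the identity is included; the inverse is automatically holomorphic). -/
def IsEllipticAutomorphism (φ : 𝔻 → 𝔻) : Prop :=
  IsHolomorphic (fun z => (φ z : ℂ)) ∧ Function.Bijective φ ∧ ∃ z : 𝔻, φ z = z

/-- `a` is the Denjoy-Wolff point of `φ`: the iterates of `φ` tend to `a` uniformly on compact
subsets of the disc. -/
def IsDenjoyWolffPoint (φ : 𝔻 → 𝔻) (a : ℂ) : Prop :=
  TendstoOnCompacts (fun n z => (φ^[n] z : ℂ)) (fun _ => a)

/-- The essential spectrum: those `μ` for which `T - μ` is not a Fredholm operator. -/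
def essSpectrum {X : Type*} [NormedAddCommGroup X] [NormedSpace ℂ X] (T : X →L[ℂ] X) : Set ℂ :=
  {μ | ¬ (T - μ • ContinuousLinearMap.id ℂ X).IsFredholm}

/-- The essential spectral radius `sup {|μ| : μ ∈ σ_e(T)}` (zero if the essential spectrum is empty,
that is, if `X` is finite-dimensional). -/
noncomputable def essSpectralRadius {X : Type*} [NormedAddCommGroup X] [NormedSpace ℂ X]
    (T : X →L[ℂ] X) : ℝ≥0∞ :=
  ⨆ μ ∈ essSpectrum T, (‖μ‖₊ : ℝ≥0∞)

/-- The partial product `w(z) w(φ(z)) ⋯ w(φ_{n-1}(z))`, with `φ_k` the `k`-th iterate of `φ`. -/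
noncomputable def weightProd (w : 𝔻 → ℂ) (φ : 𝔻 → 𝔻) (n : ℕ) (z : 𝔻) : ℂ :=
  ∏ k ∈ Finset.range n, w (φ^[k] z)

end WeightedComp

/-!
Let `T` be the weighted composition operator `f ↦ w · (f ∘ φ)`, with interior Denjoy-Wolff point `α`.
Since `(T ^ n f)(z) = W_n(z) f(φ_n(z))`, where `W_n` is the product of `w` along the first `n` points
of the orbit of `z`, and since norm convergence in `X` implies pointwise convergence, a norm limit `P`
of `T ^ n` can be read off: `W_n → 0` gives `P = 0` when `|w(α)| < 1`, and `P f = f(α) P 1` with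
`P 1 = lim W_n` when `w(α) = 1` (`IsWeightedComposition.limit_eq_zero`,
`IsWeightedComposition.limit_eq`). In both cases `P` has finite rank and `(T - P) ^ n → 0`, so `T - P`
has spectral radius less than one and its finite-rank perturbation `T` has essential spectral radius
less than one (`essSpectralRadius_lt_one_of_tendsto_pow`).

Conversely, let the essential spectral radius be less than one, so that `T - μ` is Fredholm for every
unimodular `μ`. An eigenfunction not vanishing at `α` has eigenvalue `w(α)`; comparing leading
coefficients at `α`, one vanishing there to order `n ≥ 1` has eigenvalue `w(α) φ'(α) ^ n`, which is not unimodular because `|φ'(α)| < 1`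
(`eq_zero_of_weighted_eigen`). Hence `T - μ` is injective on `Y`, where `Y` is all of `X` if
`|w(α)| < 1` and the hyperplane `{f | f(α) = 0}` if `w(α) = 1`. Being Fredholm, it is bounded below on
`Y`. As `T` is power bounded, `μ` lies in the closure of the resolvent set of `T` on `Y`, and an
operator bounded below at such a point is invertible (`notMem_spectrum_of_antilipschitz`); neither
the Fredholm index nor Riesz projections are needed. So the restriction of `T` to `Y` has spectral
radius less than one and its powers are norm-summable (`exists_summable_bound_pow`). If
`|w(α)| < 1`, this says that `T ^ n → 0`. If `w(α) = 1`, then `T - 1` maps `X` into `Y`, so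
`T ^ (n + 1) - T ^ n = T ^ n (T - 1)` is summable and `T ^ n` converges.
-/

namespace WeightedComp

/-! ### Power-bounded operators and Fredholm perturbations -/

section Operators

variable {X : Type*} [NormedAddCommGroup X] [NormedSpace ℂ X]

/-- A Fredholm operator is bounded below on every closed subspace of finite codimension that meets
its kernel trivially. -/
lemma exists_antilipschitz_domRestrict_of_isFredholm [CompleteSpace X] {A : X →L[ℂ] X}
    (hA : A.IsFredholm) {Y : Submodule ℂ X} (hY : IsClosed (Y : Set X)) (hYfin : Y.CoFG)
    (hinj : ∀ y ∈ Y, A y = 0 → y = 0) : ∃ K, AntilipschitzWith K (A.domRestrict Y) := by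
  have : CompleteSpace Y := hY.completeSpace_coe
  have hcl : IsClosed ((A.domRestrict Y).range : Set X) :=
    ((A.isStrictMap_isClosed_range_iff_restrict Y hY).1 ⟨hA.isStrictMap, hA.isClosed_range⟩).2
  refine (A.domRestrict Y).antilipschitz_of_injective_of_isClosed_range ?_ hcl
  rw [injective_iff_map_eq_zero]
  rintro ⟨y, hy⟩ h0
  exact Subtype.ext (hinj y hy h0)

lemma isFredholm_of_isUnit_sub {A F : X →L[ℂ] X} (hu : IsUnit (A - F))
    (hF : F.toLinearMap.HasFiniteRange) : A.IsFredholm := by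
  obtain ⟨u, hu⟩ := hu
  set v : X →L[ℂ] X := ↑u⁻¹
  have hA : A = u + F := by rw [hu]; abel
  have h1 : v * A - 1 = v * F := by rw [hA, mul_add, Units.inv_mul]; abel
  have h2 : A * v - 1 = F * v := by rw [hA, add_mul, Units.mul_inv]; abel
  refine ContinuousLinearMap.IsFredholm.of_isQuasiInverse (v := v) ⟨?_, ?_⟩
  · refine LinearMap.FiniteRangeSetoid.equiv_iff_hasFiniteRange.2 ?_
    have e : v.toLinearMap ∘ₗ A.toLinearMap - LinearMap.id = v.toLinearMap ∘ₗ F.toLinearMap :=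
      congrArg ContinuousLinearMap.toLinearMap h1
    exact e ▸ hF.comp_left v.toLinearMap
  · refine LinearMap.FiniteRangeSetoid.equiv_iff_hasFiniteRange.2 ?_
    have e : A.toLinearMap ∘ₗ v.toLinearMap - LinearMap.id = F.toLinearMap ∘ₗ v.toLinearMap :=
      congrArg ContinuousLinearMap.toLinearMap h2
    exact e ▸ hF.comp_right v.toLinearMap

lemma norm_pow_le_of_mem_spectrum [CompleteSpace X] {S : X →L[ℂ] X} {ν : ℂ}
    (hν : ν ∈ spectrum ℂ S) (n : ℕ) : ‖ν‖ ^ n ≤ ‖S ^ n‖ := by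
  have h := spectrum.norm_le_norm_mul_of_mem (spectrum.pow_mem_pow S n hν)
  rw [norm_pow] at h
  exact h.trans (mul_le_of_le_one_right (norm_nonneg _) ContinuousLinearMap.norm_id_le)

lemma norm_le_one_of_mem_spectrum [CompleteSpace X] {S : X →L[ℂ] X} (hS : IsPowerBounded S)
    {ν : ℂ} (hν : ν ∈ spectrum ℂ S) : ‖ν‖ ≤ 1 := by
  obtain ⟨C, hC⟩ := hS
  by_contra! h
  obtain ⟨n, hn, hn1⟩ := (((tendsto_pow_atTop_atTop_of_one_lt h).eventually_gt_atTop C).and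
    (eventually_ge_atTop 1)).exists
  exact absurd ((norm_pow_le_of_mem_spectrum hν n).trans (hC n hn1)) (not_le.2 hn)

/-- Boundary points of the spectrum are approximate eigenvalues: a point in the closure of the
resolvent set at which the operator is bounded below belongs to the resolvent set. Near such a point
the resolvent stays bounded, so the Neumann series reaches the point. -/
lemma notMem_spectrum_of_antilipschitz [CompleteSpace X] {S : X →L[ℂ] X} {μ : ℂ} {K : ℝ≥0}
    (hK : AntilipschitzWith K (S - μ • ContinuousLinearMap.id ℂ X))
    (hμ : μ ∈ closure (spectrum ℂ S)ᶜ) : μ ∉ spectrum ℂ S := by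
  rcases subsingleton_or_nontrivial X with hX | hX
  · have : Subsingleton (X →L[ℂ] X) := inferInstance
    simp [spectrum.of_subsingleton]
  have hK0 : 0 < K := by
    obtain ⟨x, hx⟩ := exists_ne (0 : X)
    rcases eq_or_ne K 0 with rfl | h
    · have := hK.le_mul_dist x 0
      simp [hx] at this
    · exact pos_iff_ne_zero.2 h
  have hKr : (0 : ℝ) < K := hK0
  obtain ⟨ν, hν, hd⟩ := Metric.mem_closure_iff.1 hμ (1 / (3 * K)) (by positivity)
  obtain ⟨u, hu⟩ := spectrum.notMem_iff.1 hν
  have hval : (u : X →L[ℂ] X) = ν • 1 - S := by rw [hu, Algebra.algebraMap_eq_smul_one]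
  -- At this distance `S - ν` is bounded below by `1 / (2 K)`, which exceeds `1 / (3 K)`.
  have hd' : ‖μ - ν‖ * K < 1 / 2 := by
    rw [dist_eq_norm, lt_div_iff₀ (by positivity)] at hd
    nlinarith [norm_nonneg (μ - ν)]
  have hinv : ‖(↑u⁻¹ : X →L[ℂ] X)‖ ≤ 2 * K := by
    refine ContinuousLinearMap.opNorm_le_bound _ (by positivity) fun y => ?_
    set x := (↑u⁻¹ : X →L[ℂ] X) y
    have hux : (u : X →L[ℂ] X) x = y := by
      change ((u : X →L[ℂ] X) * (↑u⁻¹ : X →L[ℂ] X)) y = y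
      simp
    have h1 : ‖x‖ ≤ K * ‖S x - μ • x‖ := by
      simpa [dist_eq_norm] using hK.le_mul_dist x 0
    have h2 : S x - μ • x = - y - (μ - ν) • x := by
      rw [← hux, hval]; simp [sub_smul]
    have h3 : ‖S x - μ • x‖ ≤ ‖y‖ + ‖μ - ν‖ * ‖x‖ := by
      rw [h2]; refine (norm_sub_le _ _).trans ?_; rw [norm_neg, norm_smul]
    have h4 : K * ‖S x - μ • x‖ ≤ K * (‖y‖ + ‖μ - ν‖ * ‖x‖) := by gcongr
    nlinarith [norm_nonneg x, mul_le_mul_of_nonneg_right hd'.le (norm_nonneg x)]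
  have hinv0 : 0 < ‖(↑u⁻¹ : X →L[ℂ] X)‖ := Units.norm_pos u⁻¹
  have hnear : ‖(algebraMap ℂ (X →L[ℂ] X) μ - S) - u‖ < ‖(↑u⁻¹ : X →L[ℂ] X)‖⁻¹ := by
    have : (algebraMap ℂ (X →L[ℂ] X) μ - S) - u = (μ - ν) • 1 := by
      rw [hu, Algebra.algebraMap_eq_smul_one, Algebra.algebraMap_eq_smul_one, sub_smul]; abel
    rw [this, norm_smul, norm_one, mul_one]
    refine lt_of_lt_of_le ?_ (inv_anti₀ hinv0 hinv)
    rw [inv_eq_one_div, lt_div_iff₀ (by positivity)]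
    linarith
  rw [spectrum.notMem_iff]
  exact (u.ofNearby _ hnear).isUnit

/-- A power-bounded operator that is bounded below after subtracting any unimodular scalar has
spectral radius less than one, so its powers are norm-summable. -/
lemma summable_norm_pow [CompleteSpace X] {S : X →L[ℂ] X} (hS : IsPowerBounded S)
    (hbelow : ∀ μ : ℂ, ‖μ‖ = 1 → ∃ K, AntilipschitzWith K (S - μ • ContinuousLinearMap.id ℂ X)) :
    Summable fun n => ‖S ^ n‖ := by
  rcases subsingleton_or_nontrivial X with hX | hX
  · have : Subsingleton (X →L[ℂ] X) := inferInstance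
    simp [Subsingleton.elim _ (0 : X →L[ℂ] X)]
  have hlt : ∀ ν ∈ spectrum ℂ S, ‖ν‖₊ < 1 := by
    intro ν hν
    refine lt_of_le_of_ne (norm_le_one_of_mem_spectrum hS hν) fun h => ?_
    have h1 : ‖ν‖ = 1 := congrArg NNReal.toReal h
    obtain ⟨K, hK⟩ := hbelow ν h1
    refine notMem_spectrum_of_antilipschitz hK ?_ hν
    -- `ν` is the limit of `(1 + t) ν` as `t` decreases to zero, outside the closed disc.
    have htend : Tendsto (fun t : ℝ => ((1 + t : ℝ) : ℂ) * ν) (𝓝[>] 0) (𝓝 ν) := by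
      have : Continuous fun t : ℝ => ((1 + t : ℝ) : ℂ) * ν := by fun_prop
      simpa using (this.tendsto 0).mono_left nhdsWithin_le_nhds
    refine mem_closure_of_tendsto htend ?_
    filter_upwards [self_mem_nhdsWithin] with t (ht : 0 < t) hmem
    have := norm_le_one_of_mem_spectrum hS hmem
    rw [norm_mul, h1, Complex.norm_real, Real.norm_of_nonneg (by positivity)] at this
    linarith
  obtain ⟨r, hr, hr1⟩ := ENNReal.lt_iff_exists_nnreal_btwn.1
    (spectrum.spectralRadius_lt_of_forall_lt S hlt)
  have hr1' : (r : ℝ) < 1 := by exact_mod_cast hr1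
  refine Summable.of_norm_bounded_eventually_nat
    (summable_geometric_of_lt_one r.coe_nonneg hr1') ?_
  filter_upwards [(spectrum.pow_nnnorm_pow_one_div_tendsto_nhds_spectralRadius S).eventually_lt_const
    hr, eventually_gt_atTop 0] with n hn hn0
  have hn0' : (0 : ℝ) < n := by exact_mod_cast hn0
  have h : (‖S ^ n‖₊ : ℝ≥0∞) ≤ (r : ℝ≥0∞) ^ n := by
    have := ENNReal.rpow_le_rpow hn.le hn0'.le
    rwa [← ENNReal.rpow_mul, one_div_mul_cancel hn0'.ne', ENNReal.rpow_one,
      ENNReal.rpow_natCast] at this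
  rw [norm_norm]
  exact_mod_cast h

/-- If `T` is power bounded, and `T - μ` is Fredholm and injective on a closed invariant subspace `Y`
of finite codimension for every unimodular `μ`, then the powers of `T` are norm-summable on `Y`. -/
lemma exists_summable_bound_pow [CompleteSpace X] {T : X →L[ℂ] X} (hT : IsPowerBounded T)
    {Y : Submodule ℂ X} (hY : IsClosed (Y : Set X)) (hYfin : Y.CoFG)
    (hinv : Set.MapsTo T Y Y)
    (hfred : ∀ μ : ℂ, ‖μ‖ = 1 → (T - μ • ContinuousLinearMap.id ℂ X).IsFredholm)
    (hinj : ∀ μ : ℂ, ‖μ‖ = 1 → ∀ y ∈ Y, T y = μ • y → y = 0) :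
    ∃ b : ℕ → ℝ, Summable b ∧ (∀ n, 0 ≤ b n) ∧ ∀ n, ∀ y ∈ Y, ‖(T ^ n) y‖ ≤ b n * ‖y‖ := by
  have : CompleteSpace Y := hY.completeSpace_coe
  set S : Y →L[ℂ] Y := T.restrict hinv
  have hSpow : ∀ (n : ℕ) (y : Y), ((S ^ n) y : X) = (T ^ n) y := by
    intro n
    induction n with
    | zero => intro y; rfl
    | succ n ih =>
      intro y
      rw [pow_succ, pow_succ]
      exact ih (S y)
  refine ⟨fun n => ‖S ^ n‖, summable_norm_pow ?_ ?_, fun n => norm_nonneg (S ^ n), fun n y hy => ?_⟩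
  · obtain ⟨C, hC⟩ := hT
    refine ⟨C, fun n hn => ?_⟩
    refine ContinuousLinearMap.opNorm_le_bound _ ((norm_nonneg _).trans (hC n hn)) fun y => ?_
    rw [← Submodule.norm_coe, hSpow]
    exact ((T ^ n).le_opNorm y).trans (mul_le_mul_of_nonneg_right (hC n hn) (norm_nonneg _))
  · intro μ hμ
    obtain ⟨K, hK⟩ := exists_antilipschitz_domRestrict_of_isFredholm (hfred μ hμ) hY hYfin
      (fun y hy h => hinj μ hμ y hy (by simpa [sub_eq_zero] using h))
    exact ⟨K, fun x y => hK x y⟩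
  · have := (S ^ n).le_opNorm ⟨y, hy⟩
    rwa [← Submodule.norm_coe, hSpow] at this

/-- The essential spectrum of `T` lies in the spectrum of its finite-rank perturbation `A`, and a
single power of `A` of norm less than one bounds the latter away from the unit circle. -/
lemma essSpectralRadius_lt_one_of_tendsto_pow [CompleteSpace X] {T A : X →L[ℂ] X}
    (hA : Tendsto (fun n : ℕ => A ^ n) atTop (𝓝 0))
    (hfin : (T - A).toLinearMap.HasFiniteRange) : essSpectralRadius T < 1 := by
  have hsub : essSpectrum T ⊆ spectrum ℂ A := by
    intro ν hν
    by_contra h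
    refine hν (isFredholm_of_isUnit_sub (F := T - A) ?_ hfin)
    rw [spectrum.notMem_iff, ← IsUnit.neg_iff, Algebra.algebraMap_eq_smul_one] at h
    convert h using 1
    rw [← ContinuousLinearMap.one_def]
    abel
  obtain ⟨N, hN, hN1⟩ := (((tendsto_zero_iff_norm_tendsto_zero.1 hA).eventually_lt_const
    (show (0 : ℝ) < 1 / 2 by norm_num)).and (eventually_ge_atTop 1)).exists
  have hN0 : (0 : ℝ) < N := by exact_mod_cast hN1
  set ρ : ℝ≥0 := (1 / 2) ^ (1 / N : ℝ)
  have hρ : ρ < 1 := NNReal.rpow_lt_one (by norm_num) (by positivity)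
  refine lt_of_le_of_lt (iSup₂_le fun ν hν => ?_) (by exact_mod_cast hρ : (ρ : ℝ≥0∞) < 1)
  have h := (norm_pow_le_of_mem_spectrum (hsub hν) N).trans hN.le
  have h' : ‖ν‖₊ ^ N ≤ 1 / 2 := by
    rw [← NNReal.coe_le_coe]; simpa using h
  have : ‖ν‖₊ ≤ ρ := by
    rw [show ρ = (1 / 2) ^ (N : ℝ)⁻¹ by rw [← one_div], NNReal.le_rpow_inv_iff hN0, NNReal.rpow_natCast]
    exact h'
  exact_mod_cast this

end Operators

/-! ### Holomorphic self-maps of the disc with an interior Denjoy-Wolff point -/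

section Disc

lemma coe_mem_ball (z : 𝔻) : (z : ℂ) ∈ Metric.ball (0 : ℂ) 1 :=
  mem_ball_zero_iff.2 z.norm_lt_one

lemma exists_coe_eq {z : ℂ} (hz : z ∈ Metric.ball (0 : ℂ) 1) : ∃ y : 𝔻, (y : ℂ) = z :=
  ⟨Complex.UnitDisc.mk z (mem_ball_zero_iff.1 hz), rfl⟩

lemma IsHolomorphic.continuous {f : 𝔻 → ℂ} (hf : IsHolomorphic f) : Continuous f := by
  obtain ⟨F, hF, hfF⟩ := hf
  rw [funext hfF]
  exact hF.continuousOn.comp_continuous Complex.UnitDisc.continuous_coe coe_mem_ball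

lemma IsHolomorphic.continuous_selfMap {φ : 𝔻 → 𝔻} (hφ : IsHolomorphic fun z => (φ z : ℂ)) :
    Continuous φ :=
  Complex.UnitDisc.isEmbedding_coe.continuous_iff.2 hφ.continuous

lemma TendstoOnCompacts.tendsto {F : ℕ → 𝔻 → ℂ} {g : 𝔻 → ℂ} (h : TendstoOnCompacts F g) (z : 𝔻) :
    Tendsto (fun n => F n z) atTop (𝓝 (g z)) :=
  (h {z} isCompact_singleton).tendsto_at rfl

lemma IsDenjoyWolffPoint.tendsto_iterate {φ : 𝔻 → 𝔻} {α : 𝔻} (hα : IsDenjoyWolffPoint φ α) (z : 𝔻) :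
    Tendsto (fun n => φ^[n] z) atTop (𝓝 α) :=
  Complex.UnitDisc.isEmbedding_coe.tendsto_nhds_iff.2 (TendstoOnCompacts.tendsto hα z)

lemma IsDenjoyWolffPoint.isFixedPt {φ : 𝔻 → 𝔻} {α : 𝔻} (hα : IsDenjoyWolffPoint φ α)
    (hφ : IsHolomorphic fun z => (φ z : ℂ)) : φ α = α :=
  have : T2Space 𝔻 := Complex.UnitDisc.isEmbedding_coe.t2Space
  isFixedPt_of_tendsto_iterate (hα.tendsto_iterate α) hφ.continuous_selfMap.continuousAt

lemma coe_iterate {φ : 𝔻 → 𝔻} {Φ : ℂ → ℂ} (h : ∀ z : 𝔻, (φ z : ℂ) = Φ z) (n : ℕ) (z : 𝔻) :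
    (φ^[n] z : ℂ) = Φ^[n] z :=
  Function.Semiconj.iterate_right (f := ((↑) : 𝔻 → ℂ)) h n z

/-- The multiplier of `φ` at an interior Denjoy-Wolff point has modulus less than one, because its
powers are the derivatives of the iterates of `φ`, which converge to a constant. -/
lemma norm_deriv_lt_one {φ : 𝔻 → 𝔻} {α : 𝔻} (hα : IsDenjoyWolffPoint φ α) {Φ : ℂ → ℂ}
    (hΦ : DifferentiableOn ℂ Φ (Metric.ball 0 1)) (hφΦ : ∀ z : 𝔻, (φ z : ℂ) = Φ z)
    (hfix : φ α = α) : ‖deriv Φ α‖ < 1 := by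
  have hmaps : Set.MapsTo Φ (Metric.ball 0 1) (Metric.ball 0 1) := by
    intro z hz
    obtain ⟨y, rfl⟩ := exists_coe_eq hz
    rw [← hφΦ]
    exact coe_mem_ball _
  have hderiv : ∀ n, deriv (Φ^[n]) (α : ℂ) = deriv Φ α ^ n := fun n =>
    (HasDerivAt.iterate _ (hΦ.differentiableAt (Metric.isOpen_ball.mem_nhds
      (coe_mem_ball α))).hasDerivAt (by rw [← hφΦ, hfix]) n).deriv
  have hloc : TendstoLocallyUniformlyOn (fun n => Φ^[n]) (fun _ => (α : ℂ)) atTop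
      (Metric.ball 0 1) := by
    rw [tendstoLocallyUniformlyOn_iff_forall_isCompact Metric.isOpen_ball]
    intro K hKsub hK
    have himage : ((↑) : 𝔻 → ℂ) '' ((↑) ⁻¹' K) = K :=
      Set.image_preimage_eq_of_subset fun z hz => exists_coe_eq (hKsub hz)
    have hK' : IsCompact (((↑) : 𝔻 → ℂ) ⁻¹' K) := by
      rw [Complex.UnitDisc.isEmbedding_coe.isCompact_iff, himage]
      exact hK
    have h := hα _ hK'
    rw [Metric.tendstoUniformlyOn_iff] at h ⊢
    intro ε hε
    filter_upwards [h ε hε] with n hn z hz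
    obtain ⟨y, rfl⟩ := exists_coe_eq (hKsub hz)
    rw [← coe_iterate hφΦ]
    exact hn y hz
  have hlim := (hloc.deriv (.of_forall fun n => hΦ.iterate hmaps n)
    Metric.isOpen_ball).tendsto_at (coe_mem_ball α)
  simp only [Function.comp_apply, hderiv, deriv_const'] at hlim
  exact tendsto_pow_atTop_nhds_zero_iff_norm_lt_one.1 hlim

/-- A nonzero eigenfunction with a zero of order `n ≥ 1` at `α` has eigenvalue `w(α) φ'(α) ^ n`, as the
comparison of leading coefficients shows; so there is none for a unimodular eigenvalue. -/
lemma eq_zero_of_weighted_eigen {w f : 𝔻 → ℂ} {φ : 𝔻 → 𝔻} {α : 𝔻} {μ : ℂ}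
    (hw : IsHolomorphic w) (hφ : IsHolomorphic fun z => (φ z : ℂ)) (hf : IsHolomorphic f)
    (hα : IsDenjoyWolffPoint φ α) (hwα : ‖w α‖ ≤ 1) (hμ : ‖μ‖ = 1) (hfα : f α = 0)
    (heig : ∀ z, w z * f (φ z) = μ * f z) (z : 𝔻) : f z = 0 := by
  have hfix := hα.isFixedPt hφ
  obtain ⟨W, hW, hwW⟩ := hw
  obtain ⟨Φ, hΦ, hφΦ : ∀ z : 𝔻, (φ z : ℂ) = Φ z⟩ := hφ
  obtain ⟨F, hF, hfF⟩ := hf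
  have hball : Metric.ball (0 : ℂ) 1 ∈ 𝓝 (α : ℂ) := Metric.isOpen_ball.mem_nhds (coe_mem_ball α)
  have hΦα : Φ α = α := by rw [← hφΦ, hfix]
  have hdW : DifferentiableAt ℂ W α := hW.differentiableAt hball
  have hdΦ : DifferentiableAt ℂ Φ α := hΦ.differentiableAt hball
  have hFan : AnalyticOnNhd ℂ F (Metric.ball 0 1) := hF.analyticOnNhd Metric.isOpen_ball
  by_cases hF0 : ∀ᶠ y in 𝓝 (α : ℂ), F y = 0
  · rw [hfF]
    exact hFan.eqOn_zero_of_preconnected_of_eventuallyEq_zero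
      (convex_ball (0 : ℂ) 1).isPreconnected (coe_mem_ball α) hF0 (coe_mem_ball z)
  exfalso
  obtain ⟨n, g, hg, hgα, hFg⟩ :=
    (hFan α (coe_mem_ball α)).exists_eventuallyEq_pow_smul_nonzero_iff.2 hF0
  have hn : n ≠ 0 := by
    rintro rfl
    have := hFg.self_of_nhds
    rw [← hfF, hfα] at this
    exact hgα (by simpa using this.symm)
  have hΦtend : Tendsto Φ (𝓝 (α : ℂ)) (𝓝 α) := by
    have := hdΦ.continuousAt.tendsto
    rwa [hΦα] at this
  have heq : ∀ᶠ y in 𝓝[≠] (α : ℂ),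
      W y * (slope Φ α y ^ n * g (Φ y)) = μ * g y := by
    filter_upwards [nhdsWithin_le_nhds hball, nhdsWithin_le_nhds hFg,
      nhdsWithin_le_nhds (hΦtend.eventually hFg), self_mem_nhdsWithin] with y hy h1 h2 (hne : y ≠ α)
    obtain ⟨y, rfl⟩ := exists_coe_eq hy
    have h := heig y
    rw [hwW, hfF, hfF, hφΦ, h1, h2] at h
    have hsub : (y : ℂ) - α ≠ 0 := sub_ne_zero.2 hne
    rw [slope_def_field, hΦα, div_pow]
    field_simp
    simp only [smul_eq_mul] at h
    linear_combination h
  have hlim1 : Tendsto (fun y => W y * (slope Φ α y ^ n * g (Φ y))) (𝓝[≠] (α : ℂ))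
      (𝓝 (W α * (deriv Φ α ^ n * g α))) := by
    refine (hdW.continuousAt.tendsto.mono_left nhdsWithin_le_nhds).mul
      ((hdΦ.hasDerivAt.tendsto_slope.pow n).mul ?_)
    exact (hg.continuousAt.tendsto.comp hΦtend).mono_left nhdsWithin_le_nhds
  have hlim2 : Tendsto (fun y => μ * g y) (𝓝[≠] (α : ℂ)) (𝓝 (μ * g α)) :=
    (hg.continuousAt.tendsto.mono_left nhdsWithin_le_nhds).const_mul μ
  have hlead : W α * deriv Φ α ^ n = μ := by
    refine mul_right_cancel₀ hgα ?_
    rw [mul_assoc]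
    exact tendsto_nhds_unique (hlim1.congr' heq) hlim2
  have hlt : ‖W α * deriv Φ α ^ n‖ < 1 := by
    rw [norm_mul, norm_pow, ← hwW]
    exact (mul_le_of_le_one_left (by positivity) hwα).trans_lt
      (pow_lt_one₀ (norm_nonneg _) (norm_deriv_lt_one hα hΦ hφΦ hfix) hn)
  rw [hlead, hμ] at hlt
  exact lt_irrefl _ hlt

/-- If the weight has modulus less than one at the Denjoy-Wolff point, then its products along
orbits tend to zero. -/
lemma tendsto_weightProd_zero {w : 𝔻 → ℂ} {φ : 𝔻 → 𝔻} {α : 𝔻} (hw : IsHolomorphic w)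
    (hα : IsDenjoyWolffPoint φ α) (hwα : ‖w α‖ < 1) (z : 𝔻) :
    Tendsto (fun n => weightProd w φ n z) atTop (𝓝 0) := by
  obtain ⟨r, hr, hr1⟩ := exists_between hwα
  have hev : ∀ᶠ n in atTop, ‖w (φ^[n] z)‖ < r :=
    ((hw.continuous.norm.tendsto α).comp (hα.tendsto_iterate z)).eventually_lt_const hr
  refine (summable_of_ratio_norm_eventually_le hr1 ?_).tendsto_atTop_zero
  filter_upwards [hev] with n hn
  rw [weightProd, Finset.prod_range_succ, norm_mul, mul_comm]
  exact mul_le_mul_of_nonneg_right hn.le (norm_nonneg _)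

end Disc

/-! ### Weighted composition operators on a space of holomorphic functions -/

section FunctionSpace

variable {X : Type*} [NormedAddCommGroup X] [NormedSpace ℂ X] {ι : X →L[ℂ] Hol}

/-- Evaluation at a point of the disc, as a bounded linear functional on `X`. -/
noncomputable def evL (ι : X →L[ℂ] Hol) (z : 𝔻) : X →L[ℂ] ℂ :=
  ContinuousMap.evalCLM ℂ z ∘L Hol.subtypeL ∘L ι

lemma evL_apply (f : X) (z : 𝔻) : evL ι z f = ev ι f z := rfl

lemma ev_smul (c : ℂ) (f : X) (z : 𝔻) : ev ι (c • f) z = c * ev ι f z :=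
  map_smul (evL ι z) c f

lemma isHolomorphic_ev (f : X) : IsHolomorphic (ev ι f) := (ι f).2

lemma IsHolomorphicFunctionSpace.ext (hX : IsHolomorphicFunctionSpace ι) {f g : X}
    (h : ∀ z, ev ι f z = ev ι g z) : f = g :=
  hX.injective (Subtype.ext (ContinuousMap.ext h))

lemma IsHolomorphicFunctionSpace.eq_zero (hX : IsHolomorphicFunctionSpace ι) {f : X}
    (h : ∀ z, ev ι f z = 0) : f = 0 :=
  hX.ext fun z => by rw [h z, ← evL_apply, map_zero]

/-- Norm convergence in `X` entails uniform convergence on compact subsets of the disc. -/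
lemma tendstoOnCompacts_ev {u : ℕ → X} {f : X} (h : Tendsto u atTop (𝓝 f)) :
    TendstoOnCompacts (fun n => ev ι (u n)) (ev ι f) :=
  ContinuousMap.tendsto_iff_forall_isCompact_tendstoUniformlyOn.1
    (((Hol.subtypeL ∘L ι).continuous.tendsto f).comp h)

variable {w : 𝔻 → ℂ} {φ : 𝔻 → 𝔻} {T : X →L[ℂ] X}

lemma tendsto_pow_apply {P : X →L[ℂ] X} (hP : Tendsto (fun n : ℕ => T ^ n) atTop (𝓝 P)) (f : X) :
    Tendsto (fun n : ℕ => (T ^ n) f) atTop (𝓝 (P f)) :=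
  ((ContinuousLinearMap.apply ℂ X f).continuous.tendsto P).comp hP

lemma IsWeightedComposition.ev_pow (hT : IsWeightedComposition ι w φ T) (n : ℕ) (f : X) (z : 𝔻) :
    ev ι ((T ^ n) f) z = weightProd w φ n z * ev ι f (φ^[n] z) := by
  induction n generalizing f with
  | zero => simp [weightProd]
  | succ n ih =>
    rw [pow_succ, mul_apply_eq_comp, ih, hT, weightProd, weightProd,
      Finset.prod_range_succ, Function.iterate_succ_apply', mul_assoc]

lemma tendsto_ev_iterate {α : 𝔻} (hα : IsDenjoyWolffPoint φ α) (f : X) (z : 𝔻) :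
    Tendsto (fun n => ev ι f (φ^[n] z)) atTop (𝓝 (ev ι f α)) :=
  ((isHolomorphic_ev f).continuous.tendsto α).comp (hα.tendsto_iterate z)

/-- An eigenvector of `T` with unimodular eigenvalue that vanishes at the Denjoy-Wolff point is
zero. -/
lemma IsWeightedComposition.eq_zero_of_eigen (hT : IsWeightedComposition ι w φ T)
    (hX : IsHolomorphicFunctionSpace ι) (hw : IsHolomorphic w)
    (hφ : IsHolomorphic fun z => (φ z : ℂ)) {α : 𝔻} (hα : IsDenjoyWolffPoint φ α)
    (hwα : ‖w α‖ ≤ 1) {μ : ℂ} (hμ : ‖μ‖ = 1) {f : X} (hf : T f = μ • f) (hfα : ev ι f α = 0) :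
    f = 0 :=
  hX.eq_zero <| eq_zero_of_weighted_eigen hw hφ (isHolomorphic_ev f) hα hwα hμ hfα fun z => by
    rw [← hT, hf, ev_smul]

/-- When `|w(α)| < 1`, the powers of `T` can only converge to zero. -/
lemma IsWeightedComposition.limit_eq_zero (hT : IsWeightedComposition ι w φ T)
    (hX : IsHolomorphicFunctionSpace ι) (hw : IsHolomorphic w) {α : 𝔻}
    (hα : IsDenjoyWolffPoint φ α) (hwα : ‖w α‖ < 1) {P : X →L[ℂ] X}
    (hP : Tendsto (fun n : ℕ => T ^ n) atTop (𝓝 P)) : P = 0 := by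
  ext1 f
  refine hX.eq_zero fun z => ?_
  have h1 := (tendstoOnCompacts_ev (ι := ι) (tendsto_pow_apply hP f)).tendsto z
  have h2 := (tendsto_weightProd_zero hw hα hwα z).mul (tendsto_ev_iterate (ι := ι) hα f z)
  simp only [hT.ev_pow] at h1
  simpa using tendsto_nhds_unique h1 h2

/-- When `w(α) = 1`, a norm limit `P` of the powers of `T` is `f ↦ f(α) P1`, and `P1` is the limit of
the weight products. -/
lemma IsWeightedComposition.limit_eq (hT : IsWeightedComposition ι w φ T)
    (hX : IsHolomorphicFunctionSpace ι) {α : 𝔻} (hα : IsDenjoyWolffPoint φ α)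
    (hfix : φ α = α) (hwα : w α = 1) {P : X →L[ℂ] X}
    (hP : Tendsto (fun n : ℕ => T ^ n) atTop (𝓝 P)) :
    ∃ wt : X, TendstoOnCompacts (weightProd w φ) (ev ι wt) ∧ ev ι wt α = 1 ∧
      ∀ f : X, P f = ev ι f α • wt := by
  obtain ⟨e, he⟩ := hX.one_mem
  have hlim : TendstoOnCompacts (weightProd w φ) (ev ι (P e)) := by
    have h := tendstoOnCompacts_ev (ι := ι) (tendsto_pow_apply hP e)
    have heq : (fun n => ev ι ((T ^ n) e)) = weightProd w φ := by
      ext n z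
      rw [hT.ev_pow, he, mul_one]
    rwa [heq] at h
  have hWα : ∀ n, weightProd w φ n α = 1 := fun n =>
    Finset.prod_eq_one fun k _ => by rw [Function.iterate_fixed hfix, hwα]
  refine ⟨P e, hlim, ?_, fun f => hX.ext fun z => ?_⟩
  · have h := hlim.tendsto α
    simp only [hWα] at h
    exact tendsto_nhds_unique h tendsto_const_nhds
  · have h1 := (tendstoOnCompacts_ev (ι := ι)
      (tendsto_pow_apply hP f)).tendsto z
    simp only [hT.ev_pow] at h1
    rw [ev_smul, mul_comm]
    exact tendsto_nhds_unique h1 ((hlim.tendsto z).mul (tendsto_ev_iterate hα f z))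

lemma finiteRange_of_forall_eq_smul {P : X →L[ℂ] X} {l : X → ℂ} {v : X} (hP : ∀ f, P f = l f • v) :
    P.toLinearMap.HasFiniteRange := by
  have hle : P.range ≤ Submodule.span ℂ {v} := by
    rintro _ ⟨f, rfl⟩
    exact Submodule.mem_span_singleton.2 ⟨l f, (hP f).symm⟩
  have := Submodule.finiteDimensional_of_le hle
  exact Submodule.fg_iff_finiteDimensional _ |>.2 this

/-- The limit `P` is a projection absorbing `T` on both sides, so `(T - P) ^ n = T ^ n - P` for
`n ≥ 1`. -/
lemma tendsto_sub_pow_zero {P : X →L[ℂ] X} (hP : Tendsto (fun n : ℕ => T ^ n) atTop (𝓝 P)) :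
    Tendsto (fun n : ℕ => (T - P) ^ n) atTop (𝓝 0) := by
  have hsucc : Tendsto (fun n : ℕ => T ^ (n + 1)) atTop (𝓝 P) :=
    hP.comp (tendsto_add_atTop_nat 1)
  have hTP : T * P = P := by
    refine tendsto_nhds_unique (hP.const_mul T) ?_
    simpa only [← pow_succ'] using hsucc
  have hPT : P * T = P := by
    refine tendsto_nhds_unique (hP.mul_const T) ?_
    simpa only [← pow_succ] using hsucc
  have hTnP : ∀ n : ℕ, T ^ n * P = P := fun n => by
    induction n with
    | zero => simp
    | succ n ih => rw [pow_succ, mul_assoc, hTP, ih]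
  have hPP : P * P = P := by
    refine tendsto_nhds_unique (hP.mul_const P) ?_
    simp only [hTnP, tendsto_const_nhds]
  have hpow : ∀ n : ℕ, (T - P) ^ (n + 1) = T ^ (n + 1) - P := fun n => by
    induction n with
    | zero => simp
    | succ n ih =>
      rw [pow_succ, ih, sub_mul, mul_sub, mul_sub, hTnP, hPT, hPP, ← pow_succ]; abel
  refine (tendsto_add_atTop_iff_nat 1).1 ?_
  simp only [hpow]
  simpa using hsucc.sub_const P

lemma isFredholm_of_essSpectralRadius_lt_one (h : essSpectralRadius T < 1) {μ : ℂ} (hμ : ‖μ‖ = 1) :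
    (T - μ • ContinuousLinearMap.id ℂ X).IsFredholm := by
  by_contra hn
  have h1 : (‖μ‖₊ : ℝ≥0∞) ≤ essSpectralRadius T := le_iSup₂ (f := fun μ _ => (‖μ‖₊ : ℝ≥0∞)) μ hn
  have h2 : ‖μ‖₊ = 1 := NNReal.eq hμ
  rw [h2] at h1
  exact absurd (h1.trans_lt h) (by simp)

/-- If the essential spectral radius is less than one and `|w(α)| < 1`, no unimodular number is an
eigenvalue of `T`, and the powers of `T` tend to zero. -/
lemma IsWeightedComposition.tendsto_pow_zero [CompleteSpace X]
    (hT : IsWeightedComposition ι w φ T) (hX : IsHolomorphicFunctionSpace ι)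
    (hw : IsHolomorphic w) (hφ : IsHolomorphic fun z => (φ z : ℂ)) (hpb : IsPowerBounded T)
    {α : 𝔻} (hα : IsDenjoyWolffPoint φ α) (hwα : ‖w α‖ < 1) (hr : essSpectralRadius T < 1) :
    Tendsto (fun n : ℕ => T ^ n) atTop (𝓝 0) := by
  obtain ⟨b, hb, hb0, hbound⟩ := exists_summable_bound_pow hpb (Y := ⊤) isClosed_univ
    Submodule.CoFG.top (Set.mapsTo_univ _ _)
    (fun μ hμ => isFredholm_of_essSpectralRadius_lt_one hr hμ) (fun μ hμ f _ hf => by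
      refine hT.eq_zero_of_eigen hX hw hφ hα hwα.le hμ hf ?_
      -- Evaluating the eigenvalue equation at the fixed point gives `(w α - μ) f(α) = 0`.
      have h : w α * ev ι f α = μ * ev ι f α := by
        have := hT f α
        rw [hf, hα.isFixedPt hφ, ev_smul] at this
        exact this.symm
      by_contra hne
      rw [mul_right_cancel₀ hne h] at hwα
      exact hwα.ne hμ)
  refine squeeze_zero_norm (fun n => ?_) hb.tendsto_atTop_zero
  exact ContinuousLinearMap.opNorm_le_bound _ (hb0 n) fun f => hbound n f trivial

/-- If the essential spectral radius is less than one and `w(α) = 1`, the powers of `T` decay on the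
hyperplane of functions vanishing at `α`. It contains the range of `T - 1`, so the differences
`T ^ (n + 1) - T ^ n` are summable. -/
lemma IsWeightedComposition.exists_tendsto_pow [CompleteSpace X]
    (hT : IsWeightedComposition ι w φ T) (hX : IsHolomorphicFunctionSpace ι)
    (hw : IsHolomorphic w) (hφ : IsHolomorphic fun z => (φ z : ℂ)) (hpb : IsPowerBounded T)
    {α : 𝔻} (hα : IsDenjoyWolffPoint φ α) (hwα : w α = 1) (hr : essSpectralRadius T < 1) :
    ∃ P : X →L[ℂ] X, Tendsto (fun n : ℕ => T ^ n) atTop (𝓝 P) := by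
  have hev : ∀ f, ev ι (T f) α = ev ι f α := fun f => by
    rw [hT, hα.isFixedPt hφ, hwα, one_mul]
  obtain ⟨b, hb, hb0, hbound⟩ := exists_summable_bound_pow hpb (Y := (evL ι α).ker)
    (evL ι α).isClosed_ker LinearMap.HasFiniteRange.of_isNoetherian_rng.cofg_ker
    (fun f (hf : ev ι f α = 0) => (hev f).trans hf)
    (fun μ hμ => isFredholm_of_essSpectralRadius_lt_one hr hμ)
    (fun μ hμ f hfα hf => hT.eq_zero_of_eigen hX hw hφ hα (by simp [hwα]) hμ hf hfα)
  refine cauchySeq_tendsto_of_complete (cauchySeq_of_dist_le_of_summable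
    (fun n => b n * ‖T - 1‖) (fun n => ?_) (hb.mul_right _))
  rw [dist_comm, dist_eq_norm]
  refine ContinuousLinearMap.opNorm_le_bound _ (mul_nonneg (hb0 n) (norm_nonneg _)) fun f => ?_
  have hsplit : (T ^ (n + 1) - T ^ n) f = (T ^ n) ((T - 1) f) := by
    rw [← mul_apply_eq_comp, mul_sub, mul_one, pow_succ]
  have hker : (T - 1) f ∈ (evL ι α).ker := by
    change evL ι α (T f - f) = 0
    rw [map_sub, evL_apply, evL_apply, hev, sub_self]
  rw [hsplit, mul_assoc]
  exact (hbound n _ hker).trans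
    (mul_le_mul_of_nonneg_left ((T - 1).le_opNorm f) (hb0 n))

end FunctionSpace

end WeightedComp

theorem theorem2p3 {X : Type*} [NormedAddCommGroup X] [NormedSpace ℂ X] [CompleteSpace X]
    (ι : X →L[ℂ] WeightedComp.Hol) (hX : WeightedComp.IsHolomorphicFunctionSpace ι)
    (w : 𝔻 → ℂ) (hw : WeightedComp.IsHolomorphic w)
    (φ : 𝔻 → 𝔻) (hφ : WeightedComp.IsHolomorphic (fun z => (φ z : ℂ)))
    (hφe : ¬ WeightedComp.IsEllipticAutomorphism φ)
    (T : X →L[ℂ] X) (hT : WeightedComp.IsWeightedComposition ι w φ T)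
    (hpb : WeightedComp.IsPowerBounded T)
    (α : 𝔻) (hα : WeightedComp.IsDenjoyWolffPoint φ (α : ℂ))
    (hwα : ‖w α‖ < 1 ∨ w α = 1) :
    ((∃ P : X →L[ℂ] X, Tendsto (fun n : ℕ => T ^ n) atTop (𝓝 P)) ↔
      WeightedComp.essSpectralRadius T < 1) ∧
    (∀ P : X →L[ℂ] X, Tendsto (fun n : ℕ => T ^ n) atTop (𝓝 P) →
      (‖w α‖ < 1 → P = 0) ∧
      (w α = 1 →
        P * P = P ∧ Module.finrank ℂ P.range = 1 ∧
        ∃ wt : X,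
          WeightedComp.TendstoOnCompacts (WeightedComp.weightProd w φ) (WeightedComp.ev ι wt) ∧
          ∀ f : X, P f = WeightedComp.ev ι f α • wt)) := by
  have hfix : φ α = α := hα.isFixedPt hφ
  refine ⟨⟨?_, fun hr => ?_⟩, fun P hP => ⟨fun h => hT.limit_eq_zero hX hw hα h hP, fun h => ?_⟩⟩
  · rintro ⟨P, hP⟩
    refine WeightedComp.essSpectralRadius_lt_one_of_tendsto_pow
      (WeightedComp.tendsto_sub_pow_zero hP) ?_
    rw [sub_sub_cancel]
    rcases hwα with h | h
    · rw [hT.limit_eq_zero hX hw hα h hP]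
      exact LinearMap.HasFiniteRange.zero
    · obtain ⟨wt, -, -, hPwt⟩ := hT.limit_eq hX hα hfix h hP
      exact WeightedComp.finiteRange_of_forall_eq_smul hPwt
  · rcases hwα with h | h
    · exact ⟨0, hT.tendsto_pow_zero hX hw hφ hpb hα h hr⟩
    · exact hT.exists_tendsto_pow hX hw hφ hpb hα h hr
  · obtain ⟨wt, hlim, hwt1, hPwt⟩ := hT.limit_eq hX hα hfix h hP
    have hPfix : P wt = wt := by rw [hPwt, hwt1, one_smul]
    have hwt0 : wt ≠ 0 := by
      rintro rfl
      rw [← WeightedComp.evL_apply, map_zero] at hwt1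
      exact zero_ne_one hwt1
    refine ⟨?_, ?_, wt, hlim, hPwt⟩
    · ext1 f
      rw [mul_apply_eq_comp, hPwt f, map_smul, hPfix]
    · have hrange : P.range = Submodule.span ℂ {wt} := by
        refine le_antisymm ?_ ((Submodule.span_singleton_le_iff_mem _ _).2 ⟨wt, hPfix⟩)
        rintro _ ⟨f, rfl⟩
        exact Submodule.mem_span_singleton.2 ⟨_, (hPwt f).symm⟩
      rw [hrange, finrank_span_singleton hwt0]
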